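/- **Notation.** Work with words in the digits $0,1$; $|w|$ is the length of a word $w$, $|w|_a$ the number of its digits equal to $a$, ${}^tw$ its reversal, and $\overline{w}=www\cdots$. Let $F_0=(0,1)$ and let $F_{n+1}$ be obtained from the list $F_n$ by inserting between any two consecutive words $v,v'$ the concatenation $vv'$. A Farey word is a word occurring in some $F_n$; it is non-degenerate if it is neither $0$ nor $1$. For $x\in[0,1/2]$ with binary expansion $x=0.\epsilon_1\epsilon_2\dots$ let $\phi(x)=[0;a_1,a_2,\dots]$ (regular continued fraction), where $a_1,a_2,\dots$ are the lengths of the successive maximal blocks of equal digits of $(\epsilon_j)$ (a final infinite block is dropped; the two expansions of a dyadic rational give the same value). For a non-degenerate Farey word $w$ the qumterval of label $w$ is $J_w=\phi\big((a^-,a^+)\big)$, where $a^+=0.\overline{w}$ and $a^-=0.\overline{{}^tw}-\tfrac12$ in base two. For $\alpha\in(0,1)$ and $x\in[\alpha-1,\alpha]$, $x\ne0$, put $c_\alpha(x)=\lfloor -1/x+1-\alpha\rfloor$ and $K_\alpha(x)=-1/x-c_\alpha(x)$, and let $K_\alpha(0)=0$. Put $c_{j,\alpha}(x)=c_\alpha(K_\alpha^{j-1}(x))$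 and $$\mathbf M_{\alpha,x,\ell}=\begin{pmatrix}0&-1\\1&c_{1,\alpha}(x)\end{pmatrix}\cdots\begin{pmatrix}0&-1\\1&c_{\ell,\alpha}(x)\end{pmatrix}\in PSL(2,\mathbb Z),\qquad \mathbf S=\begin{pmatrix}0&-1\\1&0\end{pmatrix},\quad \mathbf T=\begin{pmatrix}1&1\\0&1\end{pmatrix}.$$ **Theorem.** Let $w$ be a non-degenerate Farey word, $m_0=|w|_0$, $m_1=|w|_1$, and let $J_w$ be the corresponding qumterval. Then there exist two elements $\mathbf M,\mathbf M'\in PSL(2,\mathbb Z)$ such that for all $\alpha\in J_w$ $$\mathbf M_{\alpha,\alpha-1,m_0}=\mathbf M,\qquad \mathbf M_{\alpha,\alpha,m_1}=\mathbf M',$$ and moreover the matching condition $\mathbf T\mathbf M=\mathbf M'\,\mathbf S\,\mathbf T^{-1}\,\mathbf S$ holds in $PSL(2,\mathbb Z)$. -/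

import Mathlib

open scoped MatrixGroups

namespace KU

/-! ### Farey words

Words in the alphabet `{0, 1}` are lists over `Fin 2`. -/

/-- Insert between any two consecutive words `v`, `w` of a list the concatenation `v w`. -/
def insertConcat : List (List (Fin 2)) → List (List (Fin 2))
  | [] => []
  | [w] => [w]
  | v :: w :: l => v :: (v ++ w) :: insertConcat (w :: l)

/-- The Farey list of level `n`: `F_0 = (0, 1)`, and `F_{n+1}` is obtained from `F_n` by inserting
the concatenation of any two consecutive words. -/
def fareyList : ℕ → List (List (Fin 2))
  | 0 => [[0], [1]]
  | n + 1 => insertConcat (fareyList n)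

/-- The set of Farey words: the union of all Farey lists. -/
def fareyWords : Set (List (Fin 2)) := {w | ∃ n, w ∈ fareyList n}

/-- The set of non-degenerate Farey words: all Farey words but the one-digit words `0` and `1`. -/
def nondegFareyWords : Set (List (Fin 2)) := fareyWords \ {[0], [1]}

/-! ### Runlength map and continued fractions -/

open Classical in
/-- Split off the first maximal block of equal digits of an infinite binary word: the size of the
block together with the rest of the word, or `none` if the word is constant. -/
noncomputable def splitRun (ε : ℕ → Fin 2) : Option (ℕ × (ℕ → Fin 2)) :=
  if h : ∃ n, ε n ≠ ε 0 then some (Nat.find h, fun k => ε (k + Nat.find h)) else none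

/-- The runlength `RL(ε) = (a₁, a₂, …)` of an infinite binary word: the sizes of its maximal blocks
of equal digits. If the word is eventually constant, its last block is infinite; this final entry
`∞` is omitted, so that `RL(ε)` is then a finite string. -/
noncomputable def runLength (ε : ℕ → Fin 2) : Stream'.Seq ℕ :=
  Stream'.Seq.corec splitRun ε

/-- The value `[0; a₁, a₂, …]` of the continued fraction with the given finite or infinite string
of partial quotients: the limit of its convergents `0`, `[0; a₁]`, `[0; a₁, a₂]`, … (which are
eventually constant when the string is finite). -/
noncomputable def cfValue (a : Stream'.Seq ℕ) : ℝ :=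
  Filter.limUnder Filter.atTop
    (GenContFract.mk (0 : ℝ) (a.map fun k : ℕ => ⟨(1 : ℝ), (k : ℝ)⟩)).convs'

/-- The map `φ`, meant on `[0, 1/2]`: it sends `x` with binary expansion `.ε₁ε₂…` to
`[0; RL(ε)]`. For a dyadic rational `x` the expansion ending in zeros is used; the other one gives
a second continued fraction expansion of the same number. -/
noncomputable def phi (x : ℝ) : ℝ := cfValue (runLength (Real.digits x 2))

/-! ### Qumtervals -/

/-- The infinite word `w w w …` (for a nonempty word `w`). -/
def periodicWord (w : List (Fin 2)) : ℕ → Fin 2 := fun n => w.getD (n % w.length) 0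

/-- The open interval `I_w = (a⁻, a⁺)` with `a⁺ = 0.www…` and `a⁻ = 0.w'w'w'… - 1/2` in base two,
where `w'` is the transpose (reversal) of `w`. -/
noncomputable def binaryInterval (w : List (Fin 2)) : Set ℝ :=
  Set.Ioo (Real.ofDigits (periodicWord w.reverse) - 1 / 2) (Real.ofDigits (periodicWord w))

/-- The qumterval of label `w`: `J_w = φ(I_w)`. -/
noncomputable def qumterval (w : List (Fin 2)) : Set ℝ := phi '' binaryInterval w

/-! ### The maps `K_α` and the matrices of their inverse branches -/

/-- `c_α(x) = ⌊-1/x + 1 - α⌋`. -/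
noncomputable def digitC (α x : ℝ) : ℤ := ⌊-1 / x + 1 - α⌋

/-- `K_α(0) = 0` and `K_α(x) = -1/x - c_α(x)` for `x ≠ 0`. -/
noncomputable def mapK (α x : ℝ) : ℝ := if x = 0 then 0 else -1 / x - digitC α x

/-- The matrix `(0, -1; 1, c)`. -/
def branchMatrix (c : ℤ) : SL(2, ℤ) := ⟨!![0, -1; 1, c], by simp [Matrix.det_fin_two_of]⟩

/-- `PSL(2, ℤ)`, the quotient of `SL(2, ℤ)` by its centre `{1, -1}`. -/
abbrev PSL2Z : Type := Matrix.ProjectiveSpecialLinearGroup (Fin 2) ℤ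

/-- The projection `SL(2, ℤ) → PSL(2, ℤ)`. -/
def toPSL : SL(2, ℤ) →* PSL2Z := QuotientGroup.mk' (Subgroup.center SL(2, ℤ))

/-- The element of `PSL(2, ℤ)` represented by the product
`(0, -1; 1, c₁) ⋯ (0, -1; 1, c_ℓ)`, where `c_j = c_α(K_α^{j-1}(x))`. -/
noncomputable def orbitMatrix (α x : ℝ) (l : ℕ) : PSL2Z :=
  toPSL ((List.range l).map fun j => branchMatrix (digitC α ((mapK α)^[j] x))).prod

end KU

open Filter Topology

namespace KU

/-! ### Values of run-length continued fractions -/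

/-- The infinite word with its first digit removed. -/
def shift (ε : ℕ → Fin 2) : ℕ → Fin 2 := fun k => ε (k + 1)

lemma splitRun_eq_some {ε : ℕ → Fin 2} {a : ℕ} (h : ε a ≠ ε 0) (h' : ∀ m < a, ε m = ε 0) :
    splitRun ε = some (a, fun k => ε (k + a)) := by
  have hex : ∃ n, ε n ≠ ε 0 := ⟨a, h⟩
  have ha : Nat.find hex = a := (Nat.find_eq_iff hex).2 ⟨h, fun m hm => not_not.2 (h' m hm)⟩
  rw [splitRun, dif_pos hex, ha]

lemma splitRun_eq_none {ε : ℕ → Fin 2} (h : ∀ n, ε n = ε 0) : splitRun ε = none := by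
  rw [splitRun, dif_neg (by simpa using h)]

lemma splitRun_cases (ε : ℕ → Fin 2) :
    (∀ n, ε n = ε 0) ∨ ∃ a, 1 ≤ a ∧ ε a ≠ ε 0 ∧ ∀ m < a, ε m = ε 0 := by
  by_cases hex : ∃ n, ε n ≠ ε 0
  · refine Or.inr ⟨Nat.find hex, ?_, Nat.find_spec hex, fun m hm =>
      not_not.1 (Nat.find_min hex hm)⟩
    rw [Nat.one_le_iff_ne_zero]
    intro h0
    have := Nat.find_spec hex
    rw [h0] at this
    exact this rfl
  · exact Or.inl (by simpa using hex)

lemma splitRun_of_ne {ε : ℕ → Fin 2} (h : ε 1 ≠ ε 0) : splitRun ε = some (1, shift ε) :=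
  splitRun_eq_some h fun m hm => by rw [Nat.lt_one_iff.1 hm]

lemma splitRun_of_eq {ε : ℕ → Fin 2} (h : ε 1 = ε 0) :
    splitRun ε = (splitRun (shift ε)).map fun q => (q.1 + 1, q.2) := by
  rcases splitRun_cases (shift ε) with hs | ⟨a, ha, hs, hs'⟩
  · rw [splitRun_eq_none hs, Option.map_none]
    refine splitRun_eq_none fun n => ?_
    cases n with
    | zero => rfl
    | succ n => exact (hs n).trans h
  · rw [splitRun_eq_some hs hs', Option.map_some]
    refine splitRun_eq_some (a := a + 1) (fun e => hs (e.trans h.symm)) fun m hm => ?_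
    cases m with
    | zero => rfl
    | succ m => exact (hs' m (by omega)).trans h

lemma splitRun_pos {ε e : ℕ → Fin 2} {a : ℕ} (h : splitRun ε = some (a, e)) : 1 ≤ a := by
  rcases splitRun_cases ε with hs | ⟨b, hb, hs, hs'⟩
  · simp [splitRun_eq_none hs] at h
  · rw [splitRun_eq_some hs hs', Option.some_inj, Prod.mk.injEq] at h
    omega

/-- The convergents of the continued fraction of the run lengths of an infinite word. -/
noncomputable def runConv (ε : ℕ → Fin 2) (n : ℕ) : ℝ :=
  GenContFract.convs'Aux ((runLength ε).map fun k : ℕ => ⟨(1 : ℝ), (k : ℝ)⟩) n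

/-- The value of the continued fraction of the run lengths of an infinite word. -/
noncomputable def runValue (ε : ℕ → Fin 2) : ℝ := cfValue (runLength ε)

lemma runConv_none {ε : ℕ → Fin 2} (h : splitRun ε = none) (n : ℕ) : runConv ε n = 0 := by
  have : runLength ε = Stream'.Seq.nil := Stream'.Seq.corec_nil _ _ h
  cases n with
  | zero => rfl
  | succ n => simp [runConv, this, GenContFract.convs'Aux]

lemma runConv_some {ε e : ℕ → Fin 2} {a : ℕ} (h : splitRun ε = some (a, e)) (n : ℕ) :
    runConv ε (n + 1) = 1 / (a + runConv e n) := by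
  have : runLength ε = Stream'.Seq.cons a (runLength e) := Stream'.Seq.corec_cons h
  simp [runConv, this, GenContFract.convs'Aux]

lemma runConv_nonneg (n : ℕ) : ∀ ε : ℕ → Fin 2, 0 ≤ runConv ε n := by
  induction n with
  | zero => intro ε; exact le_rfl
  | succ n ih =>
    intro ε
    rcases h : splitRun ε with _ | ⟨a, e⟩
    · rw [runConv_none h]
    · rw [runConv_some h]
      have := ih e
      positivity

lemma runConv_le_one (n : ℕ) (ε : ℕ → Fin 2) : runConv ε n ≤ 1 := by
  cases n with
  | zero => exact zero_le_one
  | succ n =>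
    rcases h : splitRun ε with _ | ⟨a, e⟩
    · rw [runConv_none h]; exact zero_le_one
    · rw [runConv_some h]
      have := runConv_nonneg n e
      have ha : (1 : ℝ) ≤ a := by exact_mod_cast splitRun_pos h
      rw [div_le_one (by linarith)]
      linarith

lemma abs_two_step_sub_le {a b x y δ : ℝ} (ha : 1 ≤ a) (hb : 1 ≤ b) (hx : 0 ≤ x) (hy : 0 ≤ y)
    (h : |x - y| ≤ δ) : |1 / (a + 1 / (b + x)) - 1 / (a + 1 / (b + y))| ≤ δ / 4 := by
  have hx' : 2 ≤ a * (b + x) + 1 := by nlinarith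
  have hy' : 2 ≤ a * (b + y) + 1 := by nlinarith
  have e : 1 / (a + 1 / (b + x)) - 1 / (a + 1 / (b + y)) =
      (x - y) / ((a * (b + x) + 1) * (a * (b + y) + 1)) := by
    have h1 : b + x ≠ 0 := by positivity
    have h2 : b + y ≠ 0 := by positivity
    have h3 : a * (b + x) + 1 ≠ 0 := by positivity
    have h4 : a * (b + y) + 1 ≠ 0 := by positivity
    have e1 : 1 / (a + 1 / (b + x)) = (b + x) / (a * (b + x) + 1) := by field_simp
    have e2 : 1 / (a + 1 / (b + y)) = (b + y) / (a * (b + y) + 1) := by field_simp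
    rw [e1, e2, div_sub_div _ _ h3 h4]
    ring
  rw [e, abs_div, abs_of_pos (a := _ * _) (by positivity)]
  apply div_le_div₀ ((abs_nonneg _).trans h) h (by norm_num)
  nlinarith

lemma abs_runConv_sub_le (N : ℕ) : ∀ (ε : ℕ → Fin 2) (n m : ℕ), 2 * N ≤ n → 2 * N ≤ m →
    |runConv ε n - runConv ε m| ≤ (1 / 4) ^ N := by
  induction N with
  | zero =>
    intro ε n m _ _
    rw [pow_zero, abs_le]
    constructor <;> linarith [runConv_nonneg n ε, runConv_nonneg m ε, runConv_le_one n ε,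
      runConv_le_one m ε]
  | succ N ih =>
    intro ε n m hn hm
    obtain ⟨n, rfl⟩ : ∃ k, n = k + 1 + 1 := ⟨n - 2, by omega⟩
    obtain ⟨m, rfl⟩ : ∃ k, m = k + 1 + 1 := ⟨m - 2, by omega⟩
    rcases h : splitRun ε with _ | ⟨a, e⟩
    · simp [runConv_none h]
    rw [runConv_some h, runConv_some h]
    rcases h' : splitRun e with _ | ⟨b, f⟩
    · simp [runConv_none h']
    rw [runConv_some h', runConv_some h']
    rw [pow_succ, mul_one_div]
    exact abs_two_step_sub_le (by exact_mod_cast splitRun_pos h) (by exact_mod_cast splitRun_pos h')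
      (runConv_nonneg _ _) (runConv_nonneg _ _) (ih f n m (by omega) (by omega))

lemma tendsto_runConv (ε : ℕ → Fin 2) : Tendsto (runConv ε) atTop (𝓝 (runValue ε)) := by
  have hc : CauchySeq (runConv ε) := by
    rw [Metric.cauchySeq_iff']
    intro δ hδ
    obtain ⟨N, hN⟩ := exists_pow_lt_of_lt_one hδ (show (1 / 4 : ℝ) < 1 by norm_num)
    exact ⟨2 * N, fun n hn => (abs_runConv_sub_le N ε n (2 * N) hn le_rfl).trans_lt hN⟩
  have e : (GenContFract.mk (0 : ℝ) ((runLength ε).map fun k : ℕ => ⟨(1 : ℝ), (k : ℝ)⟩)).convs' =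
      runConv ε := by
    funext n
    exact zero_add _
  rw [runValue, cfValue, e]
  exact hc.tendsto_limUnder

lemma runValue_nonneg (ε : ℕ → Fin 2) : 0 ≤ runValue ε :=
  ge_of_tendsto' (tendsto_runConv ε) fun n => runConv_nonneg n ε

lemma runValue_none {ε : ℕ → Fin 2} (h : splitRun ε = none) : runValue ε = 0 := by
  refine tendsto_nhds_unique (tendsto_runConv ε) ?_
  rw [show runConv ε = fun _ => 0 from funext (runConv_none h)]
  exact tendsto_const_nhds

lemma runValue_some {ε e : ℕ → Fin 2} {a : ℕ} (h : splitRun ε = some (a, e)) :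
    runValue ε = 1 / (a + runValue e) := by
  refine tendsto_nhds_unique ((tendsto_runConv ε).comp (tendsto_add_atTop_nat 1)) ?_
  rw [show runConv ε ∘ (fun n => n + 1) = fun n => 1 / (a + runConv e n) from
    funext (runConv_some h)]
  have ha : (1 : ℝ) ≤ a := by exact_mod_cast splitRun_pos h
  exact tendsto_const_nhds.div ((tendsto_runConv e).const_add _)
    (by linarith [runValue_nonneg e])

lemma runValue_of_ne {ε : ℕ → Fin 2} (h : ε 1 ≠ ε 0) :
    runValue ε = 1 / (1 + runValue (shift ε)) := by
  simpa using runValue_some (splitRun_of_ne h)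

lemma runValue_of_eq {ε : ℕ → Fin 2} (h : ε 1 = ε 0) :
    runValue ε = runValue (shift ε) / (1 + runValue (shift ε)) := by
  have hs := splitRun_of_eq h
  rcases h' : splitRun (shift ε) with _ | ⟨a, e⟩
  · rw [h', Option.map_none] at hs
    rw [runValue_none hs, runValue_none h', zero_div]
  · rw [h', Option.map_some] at hs
    have ha : (1 : ℝ) ≤ a := by exact_mod_cast splitRun_pos h'
    have := runValue_nonneg e
    rw [runValue_some hs, runValue_some h']
    push_cast
    have h1 : (a : ℝ) + runValue e ≠ 0 := by positivity
    field_simp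
    ring

lemma runValue_pos {ε : ℕ → Fin 2} {n : ℕ} (h : ε n ≠ ε 0) : 0 < runValue ε := by
  rcases h' : splitRun ε with _ | ⟨a, e⟩
  · rw [splitRun, dif_pos ⟨n, h⟩] at h'
    simp at h'
  · rw [runValue_some h']
    have ha : (1 : ℝ) ≤ a := by exact_mod_cast splitRun_pos h'
    have := runValue_nonneg e
    positivity

/-! ### The extension of `φ` to `[0, 1)` -/

lemma digits_zero_of_lt {x : ℝ} (h : x < 1 / 2) : Real.digits x 2 0 = 0 := by
  have : ⌊x * (2 : ℕ) ^ (0 + 1)⌋₊ = 0 := Nat.floor_eq_zero.2 (by norm_num; linarith)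
  rw [Real.digits, this]
  rfl

lemma digits_zero_of_le {x : ℝ} (h : 1 / 2 ≤ x) (h' : x < 1) : Real.digits x 2 0 = 1 := by
  have : ⌊x * (2 : ℕ) ^ (0 + 1)⌋₊ = 1 := (Nat.floor_eq_iff (by positivity)).2 (by
    norm_num; constructor <;> linarith)
  rw [Real.digits, this]
  rfl

lemma shift_digits_half (y : ℝ) : shift (Real.digits (y / 2) 2) = Real.digits y 2 := by
  funext k
  simp only [shift, Real.digits]
  congr 2
  push_cast
  ring

lemma shift_digits_half_add {y : ℝ} (hy : 0 ≤ y) :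
    shift (Real.digits ((1 + y) / 2) 2) = Real.digits y 2 := by
  funext k
  simp only [shift, Real.digits]
  have : (1 + y) / 2 * (2 : ℕ) ^ (k + 1 + 1) = y * (2 : ℕ) ^ (k + 1) + (2 ^ (k + 1) : ℕ) := by
    push_cast
    ring
  rw [this, Nat.floor_add_natCast (by positivity)]
  apply Fin.ext
  simp [Fin.ofNat, pow_succ]

lemma exists_digits_ne {y : ℝ} (h : 1 / 2 ≤ y) (h' : y < 1) :
    ∃ n, Real.digits y 2 n ≠ Real.digits y 2 0 := by
  by_contra! hc
  have h1 : Real.digits y 2 = fun _ => Fin.last 1 := by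
    funext n
    rw [hc n, digits_zero_of_le h h']
    rfl
  have h2 := Real.ofDigits_digits (b := 2) one_lt_two (x := y) ⟨by linarith, h'⟩
  rw [h1, Real.ofDigits_const_last_eq_one 1] at h2
  exact h'.ne' h2

/-- The map sending `0.1^{a₀}0^{a₁}1^{a₂}…` in base two to `[a₀; a₁, a₂, …]`, which extends `φ`
from `[0, 1/2)` to `[0, 1)`. -/
noncomputable def phiExt (x : ℝ) : ℝ :=
  if Real.digits x 2 0 = 0 then phi x else (phi x)⁻¹

lemma phiExt_of_lt {x : ℝ} (h : x < 1 / 2) : phiExt x = phi x := by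
  rw [phiExt, if_pos (digits_zero_of_lt h)]

lemma phiExt_of_le {x : ℝ} (h : 1 / 2 ≤ x) (h' : x < 1) : phiExt x = (phi x)⁻¹ := by
  rw [phiExt, if_neg]
  rw [digits_zero_of_le h h']
  decide

lemma phi_eq_runValue (x : ℝ) : phi x = runValue (Real.digits x 2) := rfl

lemma phi_pos {y : ℝ} (h : 1 / 2 ≤ y) (h' : y < 1) : 0 < phi y :=
  let ⟨_, hn⟩ := exists_digits_ne h h'
  runValue_pos hn

lemma phiExt_nonneg (x : ℝ) : 0 ≤ phiExt x := by
  have : 0 ≤ phi x := runValue_nonneg _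
  unfold phiExt
  split_ifs
  · exact this
  · exact inv_nonneg.2 this

lemma phiExt_half {y : ℝ} (h : y < 1) : phiExt (y / 2) = phiExt y / (1 + phiExt y) := by
  have d0 := digits_zero_of_lt (x := y / 2) (by linarith)
  have d1 : Real.digits (y / 2) 2 1 = Real.digits y 2 0 := congrFun (shift_digits_half y) 0
  rw [phiExt_of_lt (by linarith), phi_eq_runValue]
  rcases lt_or_ge y (1 / 2) with hy | hy
  · rw [runValue_of_eq (by rw [d0, d1, digits_zero_of_lt hy]), shift_digits_half,
      ← phi_eq_runValue, phiExt_of_lt hy]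
  · rw [runValue_of_ne (by rw [d0, d1, digits_zero_of_le hy h]; decide), shift_digits_half,
      ← phi_eq_runValue, phiExt_of_le hy h]
    have := phi_pos hy h
    field_simp
    ring

lemma phiExt_half_add {y : ℝ} (h0 : 0 ≤ y) (h : y < 1) : phiExt ((1 + y) / 2) = 1 + phiExt y := by
  have d0 := digits_zero_of_le (x := (1 + y) / 2) (by linarith) (by linarith)
  have d1 : Real.digits ((1 + y) / 2) 2 1 = Real.digits y 2 0 :=
    congrFun (shift_digits_half_add h0) 0
  rw [phiExt_of_le (by linarith) (by linarith), phi_eq_runValue]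
  rcases lt_or_ge y (1 / 2) with hy | hy
  · rw [runValue_of_ne (by rw [d0, d1, digits_zero_of_lt hy]; decide), shift_digits_half_add h0,
      ← phi_eq_runValue, phiExt_of_lt hy, one_div, inv_inv]
  · rw [runValue_of_eq (by rw [d0, d1, digits_zero_of_le hy h]), shift_digits_half_add h0,
      ← phi_eq_runValue, phiExt_of_le hy h]
    have := phi_pos hy h
    field_simp
    ring

lemma phiExt_lt_of_pow_le (m : ℕ) : ∀ x y : ℝ, 0 ≤ x → y < 1 → (1 / 2) ^ m ≤ y - x →
    phiExt x < phiExt y := by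
  induction m with
  | zero => intro x y hx hy h; rw [pow_zero] at h; linarith
  | succ m ih =>
    intro x y hx hy h
    have hpos : (0 : ℝ) < (1 / 2) ^ (m + 1) := by positivity
    have h2 : ((1 : ℝ) / 2) ^ m ≤ 2 * y - 2 * x := by
      rw [pow_succ] at h
      linarith
    rcases lt_or_ge y (1 / 2) with hy2 | hy2
    · have := ih (2 * x) (2 * y) (by linarith) (by linarith) h2
      have e1 := phiExt_half (y := 2 * x) (by linarith)
      have e2 := phiExt_half (y := 2 * y) (by linarith)
      rw [mul_div_cancel_left₀ _ two_ne_zero] at e1 e2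
      rw [e1, e2, div_lt_div_iff₀ (by linarith [phiExt_nonneg (2 * x)])
        (by linarith [phiExt_nonneg (2 * y)])]
      linarith
    · have e2 := phiExt_half_add (y := 2 * y - 1) (by linarith) (by linarith)
      rw [show (1 + (2 * y - 1)) / 2 = y by ring] at e2
      rcases lt_or_ge x (1 / 2) with hx2 | hx2
      · have e1 := phiExt_half (y := 2 * x) (by linarith)
        rw [mul_div_cancel_left₀ _ two_ne_zero] at e1
        have n1 := phiExt_nonneg (2 * x)
        have : phiExt x < 1 := by
          rw [e1, div_lt_one (by linarith)]
          linarith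
        linarith [phiExt_nonneg (2 * y - 1)]
      · have e1 := phiExt_half_add (y := 2 * x - 1) (by linarith) (by linarith)
        rw [show (1 + (2 * x - 1)) / 2 = x by ring] at e1
        have := ih (2 * x - 1) (2 * y - 1) (by linarith) (by linarith) (by linarith)
        linarith

lemma phiExt_lt {x y : ℝ} (hx : 0 ≤ x) (hy : y < 1) (h : x < y) : phiExt x < phiExt y :=
  let ⟨m, hm⟩ := exists_pow_lt_of_lt_one (sub_pos.2 h) (show (1 / 2 : ℝ) < 1 by norm_num)
  phiExt_lt_of_pow_le m x y hx hy hm.le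

lemma phiExt_le {x y : ℝ} (hx : 0 ≤ x) (hy : y < 1) (h : x ≤ y) : phiExt x ≤ phiExt y := by
  rcases h.eq_or_lt with rfl | h
  · exact le_rfl
  · exact (phiExt_lt hx hy h).le

/-! ### Christoffel words -/

/-- The digit read at phase `k` by the rotation by `p` modulo `n`. -/
def phaseDigit (n p k : ℕ) : Fin 2 := if n ≤ k + p then 1 else 0

/-- The lower Christoffel word of length `n` with `p` digits `1`. -/
def christoffel (n p : ℕ) : List (Fin 2) := (List.range n).map fun j => phaseDigit n p (j * p % n)

lemma mod_eq_of_eq_mul_add {a q r n : ℕ} (h : a = q * n + r) (hr : r < n) : a % n = r := by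
  rw [h, Nat.mul_add_mod', Nat.mod_eq_of_lt hr]

lemma phaseDigit_add_left {n₁ p₁ n₂ p₂ j : ℕ} (h : p₂ * n₁ = p₁ * n₂ + 1) (hj : j < n₁)
    (h₂ : 0 < n₂) :
    phaseDigit (n₁ + n₂) (p₁ + p₂) (j * (p₁ + p₂) % (n₁ + n₂)) =
      phaseDigit n₁ p₁ (j * p₁ % n₁) := by
  have hr : j * p₁ % n₁ < n₁ := Nat.mod_lt _ (by omega)
  have hq := Nat.div_add_mod (j * p₁) n₁
  set r := j * p₁ % n₁
  set q := j * p₁ / n₁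
  have e : n₁ * (j * (p₁ + p₂)) = n₁ * (q * (n₁ + n₂)) + (r * (n₁ + n₂) + j) := by
    zify at *
    linear_combination j * h - (n₁ + n₂) * hq
  have hle : q * (n₁ + n₂) ≤ j * (p₁ + p₂) :=
    le_of_mul_le_mul_left (a := n₁) (by omega) (by omega)
  obtain ⟨s, hs⟩ := Nat.exists_eq_add_of_le hle
  rw [hs, mul_add] at e
  have e' : n₁ * s = r * (n₁ + n₂) + j := by omega
  have hs_lt : s < n₁ + n₂ := by
    refine lt_of_mul_lt_mul_left (a := n₁) ?_ (Nat.zero_le _)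
    have : (r + 1) * (n₁ + n₂) ≤ n₁ * (n₁ + n₂) := Nat.mul_le_mul_right _ hr
    rw [add_mul] at this
    omega
  rw [mod_eq_of_eq_mul_add hs hs_lt]
  unfold phaseDigit
  congr 1
  rw [eq_iff_iff]
  have e2 : n₁ * (s + (p₁ + p₂)) = (r + p₁) * (n₁ + n₂) + (j + 1) := by
    zify at *
    linear_combination e' + h
  constructor
  · intro hle
    by_contra! hlt
    have h1 := Nat.mul_le_mul_left n₁ hle
    have : (r + p₁ + 1) * (n₁ + n₂) ≤ n₁ * (n₁ + n₂) := Nat.mul_le_mul_right _ hlt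
    rw [add_mul] at this
    omega
  · intro hle
    refine le_of_mul_le_mul_left (a := n₁) ?_ (by omega)
    have := Nat.mul_le_mul_right (n₁ + n₂) hle
    omega

lemma phaseDigit_add_right {n₁ p₁ n₂ p₂ i : ℕ} (h : p₂ * n₁ = p₁ * n₂ + 1) (hi : i < n₂)
    (h₁ : 0 < n₁) :
    phaseDigit (n₁ + n₂) (p₁ + p₂) ((n₁ + i) * (p₁ + p₂) % (n₁ + n₂)) =
      phaseDigit n₂ p₂ (i * p₂ % n₂) := by
  have hr : i * p₂ % n₂ < n₂ := Nat.mod_lt _ (by omega)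
  have hq := Nat.div_add_mod (i * p₂) n₂
  set r := i * p₂ % n₂
  set q := i * p₂ / n₂
  obtain ⟨l, hl⟩ := Nat.exists_eq_add_of_lt hi
  have e : n₂ * ((n₁ + i) * (p₁ + p₂)) =
      n₂ * ((p₁ + q) * (n₁ + n₂)) + (r * (n₁ + n₂) + (l + 1)) := by
    zify at *
    linear_combination (n₂ - i) * h - (n₁ + n₂) * hq + hl
  have hle : (p₁ + q) * (n₁ + n₂) ≤ (n₁ + i) * (p₁ + p₂) :=
    le_of_mul_le_mul_left (a := n₂) (by omega) (by omega)
  obtain ⟨s, hs⟩ := Nat.exists_eq_add_of_le hle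
  rw [hs, mul_add] at e
  have e' : n₂ * s = r * (n₁ + n₂) + (l + 1) := by omega
  have hs_lt : s < n₁ + n₂ := by
    refine lt_of_mul_lt_mul_left (a := n₂) ?_ (Nat.zero_le _)
    have : (r + 1) * (n₁ + n₂) ≤ n₂ * (n₁ + n₂) := Nat.mul_le_mul_right _ hr
    rw [add_mul] at this
    omega
  rw [mod_eq_of_eq_mul_add hs hs_lt]
  unfold phaseDigit
  congr 1
  rw [eq_iff_iff]
  have e2 : n₂ * (s + (p₁ + p₂)) = (r + p₂) * (n₁ + n₂) + l := by
    zify at *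
    linear_combination e' - h
  constructor
  · intro hle
    by_contra! hlt
    have h1 := Nat.mul_le_mul_left n₂ hle
    have : (r + p₂ + 1) * (n₁ + n₂) ≤ n₂ * (n₁ + n₂) := Nat.mul_le_mul_right _ hlt
    rw [add_mul] at this
    omega
  · intro hle
    refine le_of_mul_le_mul_left (a := n₂) ?_ (by omega)
    have := Nat.mul_le_mul_right (n₁ + n₂) hle
    omega

lemma christoffel_append {n₁ p₁ n₂ p₂ : ℕ} (h : p₂ * n₁ = p₁ * n₂ + 1) (h₁ : 0 < n₁)
    (h₂ : 0 < n₂) :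
    christoffel n₁ p₁ ++ christoffel n₂ p₂ = christoffel (n₁ + n₂) (p₁ + p₂) := by
  rw [christoffel, christoffel, christoffel, List.range_add, List.map_append, List.map_map]
  congr 1
  · refine List.map_congr_left fun j hj => ?_
    exact (phaseDigit_add_left h (List.mem_range.1 hj) h₂).symm
  · refine List.map_congr_left fun j hj => ?_
    exact (phaseDigit_add_right h (List.mem_range.1 hj) h₁).symm

/-- Two Christoffel words whose slopes are Farey neighbours. -/
def IsFareyPair (v w : List (Fin 2)) : Prop :=
  ∃ n₁ p₁ n₂ p₂ : ℕ, 0 < n₁ ∧ 0 < n₂ ∧ p₁ ≤ n₁ ∧ p₂ ≤ n₂ ∧ p₂ * n₁ = p₁ * n₂ + 1 ∧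
    v = christoffel n₁ p₁ ∧ w = christoffel n₂ p₂

/-- The Christoffel words with coprime parameters. -/
def IsChristoffel (w : List (Fin 2)) : Prop :=
  ∃ n p : ℕ, 0 < n ∧ p ≤ n ∧ p.Coprime n ∧ w = christoffel n p

lemma IsFareyPair.append {v w : List (Fin 2)} (h : IsFareyPair v w) :
    IsFareyPair v (v ++ w) ∧ IsFareyPair (v ++ w) w := by
  obtain ⟨n₁, p₁, n₂, p₂, h₁, h₂, hp₁, hp₂, h, rfl, rfl⟩ := h
  rw [christoffel_append h h₁ h₂]
  refine ⟨⟨n₁, p₁, n₁ + n₂, p₁ + p₂, h₁, by omega, hp₁, by omega, ?_, rfl, rfl⟩,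
    ⟨n₁ + n₂, p₁ + p₂, n₂, p₂, by omega, h₂, by omega, hp₂, ?_, rfl, rfl⟩⟩
  · linear_combination h
  · linear_combination h

lemma IsFareyPair.isChristoffel_append {v w : List (Fin 2)} (h : IsFareyPair v w) :
    IsChristoffel (v ++ w) := by
  obtain ⟨n₁, p₁, n₂, p₂, h₁, h₂, hp₁, hp₂, h, rfl, rfl⟩ := h
  refine ⟨n₁ + n₂, p₁ + p₂, by omega, by omega, ?_, christoffel_append h h₁ h₂⟩
  have e : (p₁ + p₂) * n₁ = (n₁ + n₂) * p₁ + 1 := by linear_combination h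
  refine Nat.dvd_one.1 ?_
  exact (Nat.dvd_add_right ((Nat.gcd_dvd_right _ _).mul_right p₁)).1
    (e ▸ (Nat.gcd_dvd_left _ _).mul_right n₁)

lemma isChain_insertConcat : ∀ l : List (List (Fin 2)), l.IsChain IsFareyPair →
    (insertConcat l).IsChain IsFareyPair
  | [], _ => .nil
  | [w], _ => .singleton w
  | v :: w :: l, h => by
    rw [List.isChain_cons_cons] at h
    have ih := isChain_insertConcat (w :: l) h.2
    rw [insertConcat, List.isChain_cons_cons]
    refine ⟨h.1.append.1, ?_⟩
    cases l with
    | nil => exact List.isChain_pair.2 h.1.append.2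
    | cons x l =>
      rw [insertConcat] at ih ⊢
      exact List.isChain_cons_cons.2 ⟨h.1.append.2, ih⟩

lemma isChristoffel_of_mem_insertConcat : ∀ l : List (List (Fin 2)), l.IsChain IsFareyPair →
    (∀ x ∈ l, IsChristoffel x) → ∀ x ∈ insertConcat l, IsChristoffel x
  | [], _, _ => by simp [insertConcat]
  | [w], _, hl => hl
  | v :: w :: l, h, hl => by
    rw [List.isChain_cons_cons] at h
    have ih := isChristoffel_of_mem_insertConcat (w :: l) h.2 fun x hx => hl x (.tail _ hx)
    intro x hx
    rw [insertConcat, List.mem_cons, List.mem_cons] at hx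
    rcases hx with rfl | rfl | hx
    · exact hl _ (.head _)
    · exact h.1.isChristoffel_append
    · exact ih x hx

lemma fareyList_spec (m : ℕ) :
    (fareyList m).IsChain IsFareyPair ∧ ∀ x ∈ fareyList m, IsChristoffel x := by
  induction m with
  | zero =>
    refine ⟨List.isChain_pair.2 ⟨1, 0, 1, 1, by decide⟩, fun x hx => ?_⟩
    simp only [fareyList, List.mem_cons, List.not_mem_nil, or_false] at hx
    rcases hx with rfl | rfl
    · exact ⟨1, 0, by decide⟩
    · exact ⟨1, 1, by decide⟩
  | succ m ih =>
    exact ⟨isChain_insertConcat _ ih.1, isChristoffel_of_mem_insertConcat _ ih.1 ih.2⟩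

lemma exists_christoffel_of_mem {w : List (Fin 2)} (hw : w ∈ nondegFareyWords) :
    ∃ n p : ℕ, 0 < p ∧ p < n ∧ p.Coprime n ∧ w = christoffel n p := by
  obtain ⟨⟨m, hm⟩, hne⟩ := hw
  obtain ⟨n, p, hn, hp, hc, rfl⟩ := (fareyList_spec m).2 w hm
  refine ⟨n, p, Nat.pos_of_ne_zero ?_, lt_of_le_of_ne hp ?_, hc, rfl⟩
  · rintro rfl
    obtain rfl : n = 1 := by simpa using hc
    exact hne (Or.inl (by decide))
  · rintro rfl
    obtain rfl : p = 1 := by simpa using hc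
    exact hne (Or.inr (by decide))

/-- The central word `u` with `christoffel n p = 0u1`. -/
def centralWord (n p : ℕ) : List (Fin 2) :=
  (List.range (n - 2)).map fun j => phaseDigit n p ((j + 1) * p % n)

lemma phase_last {n p : ℕ} (hp : 0 < p) (hpn : p < n) : (n - 2 + 1) * p % n = n - p := by
  obtain ⟨m, rfl⟩ : ∃ m, n = m + 2 := ⟨n - 2, by omega⟩
  obtain ⟨q, rfl⟩ : ∃ q, p = q + 1 := ⟨p - 1, by omega⟩
  refine mod_eq_of_eq_mul_add (q := q) ?_ (by omega)
  rw [Nat.add_sub_cancel]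
  zify [hpn.le]
  ring

lemma christoffel_eq {n p : ℕ} (hp : 0 < p) (hpn : p < n) :
    christoffel n p = 0 :: (centralWord n p ++ [1]) := by
  have e := phase_last hp hpn
  obtain ⟨m, rfl⟩ : ∃ m, n = m + 2 := ⟨n - 2, by omega⟩
  rw [Nat.add_sub_cancel] at e
  rw [christoffel, List.range_succ_eq_map, List.range_succ, centralWord]
  simp only [List.map_cons, List.map_append, List.map_map, List.map_nil, Nat.add_sub_cancel]
  congr 1
  · simp [phaseDigit, hpn]
  · congr 1
    rw [e, phaseDigit, if_pos (by omega)]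

/-- The infinite word read from phase `k` by the rotation by `p` modulo `n`. -/
def phaseWord (n p k : ℕ) : ℕ → Fin 2 := fun j => phaseDigit n p ((k + j * p) % n)

lemma christoffel_length (n p : ℕ) : (christoffel n p).length = n := by simp [christoffel]

lemma periodicWord_christoffel {n : ℕ} (p : ℕ) (hn : 0 < n) :
    periodicWord (christoffel n p) = phaseWord n p 0 := by
  funext i
  have hi : i % n < n := Nat.mod_lt _ hn
  rw [periodicWord, christoffel_length, List.getD_eq_getElem _ _ (by simpa [christoffel] using hi),
    phaseWord]
  simp [christoffel, Nat.mod_mul_mod]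

lemma periodicWord_reverse_christoffel {n p : ℕ} (hpn : p < n) :
    periodicWord (christoffel n p).reverse = phaseWord n p (n - 1) := by
  have hn : 0 < n := by omega
  funext i
  have hi : i % n < n := Nat.mod_lt _ hn
  rw [periodicWord, List.length_reverse, christoffel_length, List.getD_eq_getElem _ _ (by
    simpa [christoffel] using hi), phaseWord]
  have e0 : (n - 1 + i * p) % n = (n - 1 + (i % n) * p) % n := by
    rw [Nat.add_mod, ← Nat.mod_mul_mod, ← Nat.add_mod]
  rw [e0]
  simp only [christoffel, List.getElem_reverse, List.getElem_map, List.getElem_range,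
    List.length_map, List.length_range]
  generalize i % n = j at hi
  have hm : (j + 1) * p % n < n := Nat.mod_lt _ hn
  have hq := Nat.div_add_mod ((j + 1) * p) n
  set m := (j + 1) * p % n
  set q := (j + 1) * p / n
  obtain ⟨l, rfl⟩ : ∃ l, n = j + 1 + l := Nat.exists_eq_add_of_le hi
  rw [show j + 1 + l - 1 - j = l by omega]
  have hs : l * p + (q * (j + 1 + l) + m) = p * (j + 1 + l) := by linear_combination hq
  have e2 : j + 1 + l - 1 + j * p + (p + 1) = (q + 1) * (j + 1 + l) + m := by
    rw [show j + 1 + l - 1 = j + l by omega]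
    linear_combination -hq
  set n := j + 1 + l
  have e1 : l * p % n = if m = 0 then 0 else n - m := by
    have hqp : q ≤ p := le_of_mul_le_mul_right (a := n) (by omega) (by omega)
    obtain ⟨d, hd⟩ := Nat.exists_eq_add_of_le hqp
    have hdn : p * n = q * n + d * n := by rw [← add_mul, ← hd]
    split_ifs with h0
    · refine mod_eq_of_eq_mul_add (q := d) (by omega) hn
    · have : d ≠ 0 := by
        rintro rfl
        rw [zero_mul] at hdn
        omega
      obtain ⟨c, rfl⟩ : ∃ c, d = c + 1 := ⟨d - 1, by omega⟩
      rw [add_mul c] at hdn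
      refine mod_eq_of_eq_mul_add (q := c) (by omega) (by omega)
  have e3 : (n - 1 + j * p) % n = if p + 1 ≤ m then m - (p + 1) else n + m - (p + 1) := by
    split_ifs with h0
    · exact mod_eq_of_eq_mul_add (q := q + 1) (by omega) (by omega)
    · rw [add_mul] at e2
      exact mod_eq_of_eq_mul_add (q := q) (by omega) (by omega)
  rw [e1, e3]
  unfold phaseDigit
  split_ifs <;> first | rfl | omega

/-! ### Words as products of generators -/

/-- The generator `(1, 0; 1, 1)`. -/
def lowerGen : SL(2, ℤ) := ⟨!![1, 0; 1, 1], by simp [Matrix.det_fin_two_of]⟩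

lemma coe_branchMatrix (c : ℤ) :
    (branchMatrix c : Matrix (Fin 2) (Fin 2) ℤ) = !![0, -1; 1, c] := rfl

lemma coe_lowerGen : (lowerGen : Matrix (Fin 2) (Fin 2) ℤ) = !![1, 0; 1, 1] := rfl

/-- The generator attached to a digit. -/
def digitMatrix (a : Fin 2) : SL(2, ℤ) := if a = 0 then lowerGen else ModularGroup.T

/-- The product of the generators attached to the digits of a word. -/
def wordMatrix (s : List (Fin 2)) : SL(2, ℤ) := (s.map digitMatrix).prod

/-- The action on reals of the generator attached to a digit. -/
noncomputable def digitAct (a : Fin 2) (t : ℝ) : ℝ := if a = 0 then t / (1 + t) else 1 + t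

/-- The action on reals of a word. -/
noncomputable def wordAct (s : List (Fin 2)) (t : ℝ) : ℝ := s.foldr digitAct t

/-- The concatenation of the blocks `a b^k`, for `k` running through a list. -/
def blocks (a b : Fin 2) (ks : List ℕ) : List (Fin 2) :=
  ks.flatMap fun k => a :: List.replicate k b

lemma blocks_cons (a b : Fin 2) (k : ℕ) (ks : List ℕ) :
    blocks a b (k :: ks) = a :: (List.replicate k b ++ blocks a b ks) := rfl

lemma exists_blocks {a b : Fin 2} (hab : a ≠ b) (s : List (Fin 2)) :
    ∃ k ks, s = List.replicate k b ++ blocks a b ks := by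
  induction s with
  | nil => exact ⟨0, [], rfl⟩
  | cons x s ih =>
    obtain ⟨k, ks, rfl⟩ := ih
    rcases (by omega : x = a ∨ x = b) with rfl | rfl
    · exact ⟨0, k :: ks, rfl⟩
    · exact ⟨k + 1, ks, rfl⟩

lemma count_blocks {a b : Fin 2} (hab : a ≠ b) (ks : List ℕ) :
    (blocks a b ks).count a = ks.length := by
  induction ks with
  | nil => rfl
  | cons k ks ih =>
    rw [blocks_cons, List.count_cons_self, List.count_append, List.count_replicate, ih]
    simp [hab.symm]

lemma blocks_eq_nil_or_head (a b : Fin 2) (ks : List ℕ) :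
    blocks a b ks = [] ∨ (blocks a b ks).head? = some a := by
  cases ks with
  | nil => exact Or.inl rfl
  | cons k ks => exact Or.inr rfl

lemma wordAct_append (s s' : List (Fin 2)) (t : ℝ) :
    wordAct (s ++ s') t = wordAct s (wordAct s' t) := List.foldr_append

lemma wordAct_nonneg {t : ℝ} (ht : 0 ≤ t) (s : List (Fin 2)) : 0 ≤ wordAct s t := by
  induction s with
  | nil => exact ht
  | cons a s ih =>
    change 0 ≤ digitAct a (wordAct s t)
    unfold digitAct
    split_ifs <;> positivity

lemma wordAct_pos {t : ℝ} (ht : 0 < t) (s : List (Fin 2)) : 0 < wordAct s t := by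
  induction s with
  | nil => exact ht
  | cons a s ih =>
    change 0 < digitAct a (wordAct s t)
    unfold digitAct
    split_ifs <;> positivity

lemma wordAct_replicate_one (k : ℕ) (t : ℝ) : wordAct (List.replicate k 1) t = k + t := by
  induction k with
  | zero => simp [wordAct]
  | succ k ih =>
    change 1 + wordAct (List.replicate k 1) t = _
    rw [ih]
    push_cast
    ring

lemma wordAct_replicate_zero (k : ℕ) {t : ℝ} (ht : 0 < t) :
    (wordAct (List.replicate k 0) t)⁻¹ = k + t⁻¹ := by
  induction k with
  | zero => simp [wordAct]
  | succ k ih =>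
    change (wordAct (List.replicate k 0) t / (1 + wordAct (List.replicate k 0) t))⁻¹ = _
    have hpos := wordAct_pos ht (List.replicate k 0)
    push_cast
    rw [show (k : ℝ) + 1 + t⁻¹ = 1 + (wordAct (List.replicate k 0) t)⁻¹ by rw [ih]; ring]
    field_simp
    ring

/-! ### Orbits of the maps `K_α` -/

lemma digitC_and_mapK {α x y : ℝ} {c : ℤ} (hx : x ≠ 0) (h : -1 / x = c + y) (h₁ : α - 1 ≤ y)
    (h₂ : y < α) : digitC α x = c ∧ mapK α x = y := by
  have hc : digitC α x = c := by
    rw [digitC, Int.floor_eq_iff, h]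
    constructor <;> linarith
  refine ⟨hc, ?_⟩
  rw [mapK, if_neg hx, hc, h]
  ring

lemma orbitDigits_cons {α x y : ℝ} {c : ℤ} (hx : x ≠ 0) (h : -1 / x = c + y) (h₁ : α - 1 ≤ y)
    (h₂ : y < α) (l : ℕ) :
    (List.range (l + 1)).map (fun j => branchMatrix (digitC α ((mapK α)^[j] x))) =
      branchMatrix c :: (List.range l).map fun j => branchMatrix (digitC α ((mapK α)^[j] y)) := by
  obtain ⟨hc, hk⟩ := digitC_and_mapK hx h h₁ h₂
  rw [List.range_succ_eq_map, List.map_cons, List.map_map, Function.iterate_zero_apply, hc]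
  congr 1
  refine List.map_congr_left fun j _ => ?_
  rw [Function.comp_apply, Function.iterate_succ_apply, hk]

lemma orbitDigits_blocks_zero {α τ : ℝ} (hτ : 0 ≤ τ) (ks : List ℕ)
    (h : ∀ s, s <:+ (blocks 0 1 ks).tail → (s = [] ∨ s.head? = some 0) →
      α ≤ wordAct s τ ∧ wordAct s τ < 1 + α) :
    (List.range ks.length).map (fun j => branchMatrix (digitC α ((mapK α)^[j]
      (wordAct (blocks 0 1 ks) τ - 1)))) = ks.map fun k : ℕ => branchMatrix (k + 2) := by
  induction ks with
  | nil => rfl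
  | cons k ks ih =>
    have hsuf : blocks 0 1 ks <:+ (blocks 0 1 (k :: ks)).tail := List.suffix_append _ _
    obtain ⟨h₁, h₂⟩ := h _ hsuf (blocks_eq_nil_or_head 0 1 ks)
    have hnn := wordAct_nonneg hτ (blocks 0 1 ks)
    have e : wordAct (blocks 0 1 (k :: ks)) τ - 1 = -1 / (1 + (k + wordAct (blocks 0 1 ks) τ)) := by
      change wordAct (List.replicate k 1 ++ blocks 0 1 ks) τ /
        (1 + wordAct (List.replicate k 1 ++ blocks 0 1 ks) τ) - 1 = _
      rw [wordAct_append, wordAct_replicate_one]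
      have : (1 : ℝ) + (k + wordAct (blocks 0 1 ks) τ) ≠ 0 := by positivity
      field_simp
      ring
    have hpos : (0 : ℝ) < 1 + (k + wordAct (blocks 0 1 ks) τ) := by positivity
    rw [List.length_cons, orbitDigits_cons (c := k + 2) (y := wordAct (blocks 0 1 ks) τ - 1),
      List.map_cons, ih fun s hs => h s (hs.trans ((List.tail_suffix _).trans hsuf))]
    · rw [e]
      exact div_ne_zero (by norm_num) hpos.ne'
    · rw [e]
      push_cast
      field_simp
      ring
    · linarith
    · linarith

lemma orbitDigits_blocks_one {α τ : ℝ} (hτ : 0 < τ) (ks : List ℕ)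
    (h : ∀ s, s <:+ (blocks 1 0 ks).tail → (s = [] ∨ s.head? = some 1) →
      α - 1 ≤ 1 - (wordAct s τ)⁻¹ ∧ 1 - (wordAct s τ)⁻¹ < α) :
    (List.range ks.length).map (fun j => branchMatrix (digitC α ((mapK α)^[j]
      (1 - (wordAct (blocks 1 0 ks) τ)⁻¹)))) = ks.map fun k : ℕ => branchMatrix (-(k + 2)) := by
  induction ks with
  | nil => rfl
  | cons k ks ih =>
    have hsuf : blocks 1 0 ks <:+ (blocks 1 0 (k :: ks)).tail := List.suffix_append _ _
    obtain ⟨h₁, h₂⟩ := h _ hsuf (blocks_eq_nil_or_head 1 0 ks)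
    have hp := wordAct_pos hτ (blocks 1 0 ks)
    have hpos : (0 : ℝ) < 1 + (k + (wordAct (blocks 1 0 ks) τ)⁻¹) := by positivity
    have e : 1 - (wordAct (blocks 1 0 (k :: ks)) τ)⁻¹ =
        1 / (1 + (k + (wordAct (blocks 1 0 ks) τ)⁻¹)) := by
      change 1 - (1 + wordAct (List.replicate k 0 ++ blocks 1 0 ks) τ)⁻¹ = _
      rw [wordAct_append, ← wordAct_replicate_zero k hp]
      have := wordAct_pos hp (List.replicate k 0)
      field_simp
      ring
    rw [List.length_cons, orbitDigits_cons (c := -(k + 2))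
      (y := 1 - (wordAct (blocks 1 0 ks) τ)⁻¹) _ _ h₁ h₂,
      List.map_cons, ih fun s hs => h s (hs.trans ((List.tail_suffix _).trans hsuf))]
    · rw [e]
      exact div_ne_zero (by norm_num) hpos.ne'
    · rw [e, div_div_eq_mul_div, div_one]
      push_cast
      ring

/-! ### The matching identity -/

lemma toPSL_neg (g : SL(2, ℤ)) : toPSL (-g) = toPSL g := by
  refine (QuotientGroup.eq (s := Subgroup.center SL(2, ℤ))).2 ?_
  rw [Subgroup.mem_center_iff]
  intro h
  simp

lemma branchMatrix_add_one (c : ℤ) : branchMatrix (c + 1) = branchMatrix c * ModularGroup.T := by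
  refine Subtype.ext ?_
  simp [coe_branchMatrix, ModularGroup.coe_T, add_comm]

lemma T_mul_branchMatrix (k : ℕ) : ModularGroup.T * branchMatrix (k + 2) =
    lowerGen * ModularGroup.T ^ k * ModularGroup.T := by
  induction k with
  | zero =>
    refine Subtype.ext ?_
    simp [coe_branchMatrix, coe_lowerGen, ModularGroup.coe_T]
  | succ k ih =>
    rw [show ((k + 1 : ℕ) : ℤ) + 2 = k + 2 + 1 by push_cast; ring, branchMatrix_add_one,
      ← mul_assoc, ih, pow_succ]
    group

/-- The matrix `(1, -1; 1, 0)`. -/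
def flipMatrix : SL(2, ℤ) := ModularGroup.T * ModularGroup.S

lemma branchMatrix_mul_flipMatrix (k : ℕ) : branchMatrix (-(k + 2)) * flipMatrix =
    -(flipMatrix * (ModularGroup.T * lowerGen ^ k)) := by
  induction k with
  | zero =>
    refine Subtype.ext ?_
    simp [coe_branchMatrix, ModularGroup.coe_S, ModularGroup.coe_T, flipMatrix]
  | succ k ih =>
    have h1 : branchMatrix (-(k + 2)) =
        branchMatrix (-(((k + 1 : ℕ) : ℤ) + 2)) * ModularGroup.T := by
      rw [← branchMatrix_add_one]
      congr 1
    have h2 : flipMatrix * lowerGen = ModularGroup.S := by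
      refine Subtype.ext ?_
      simp [coe_lowerGen, ModularGroup.coe_S, ModularGroup.coe_T, flipMatrix]
    rw [h1, mul_assoc] at ih
    have h3 : ModularGroup.T⁻¹ * flipMatrix = flipMatrix * lowerGen := by
      rw [h2, flipMatrix, inv_mul_cancel_left]
    have h4 : flipMatrix = ModularGroup.T * flipMatrix * lowerGen := by
      rw [mul_assoc, ← h3, mul_inv_cancel_left]
    conv_lhs => rw [h4]
    rw [← mul_assoc, ih, pow_succ, neg_mul]
    simp only [mul_assoc]

lemma wordMatrix_append (s s' : List (Fin 2)) :
    wordMatrix (s ++ s') = wordMatrix s * wordMatrix s' := by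
  simp [wordMatrix]

lemma wordMatrix_replicate (k : ℕ) (a : Fin 2) :
    wordMatrix (List.replicate k a) = digitMatrix a ^ k := by
  simp [wordMatrix]

lemma wordMatrix_cons (a : Fin 2) (s : List (Fin 2)) :
    wordMatrix (a :: s) = digitMatrix a * wordMatrix s := by
  simp [wordMatrix]

lemma T_mul_prod_branchMatrix (ks : List ℕ) :
    ModularGroup.T * (ks.map fun k : ℕ => branchMatrix (k + 2)).prod =
      wordMatrix (blocks 0 1 ks) * ModularGroup.T := by
  induction ks with
  | nil => simp [blocks, wordMatrix]
  | cons k ks ih =>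
    rw [blocks_cons, wordMatrix_cons, wordMatrix_append, wordMatrix_replicate, List.map_cons,
      List.prod_cons, ← mul_assoc, T_mul_branchMatrix, mul_assoc _ ModularGroup.T, ih]
    simp only [digitMatrix, if_pos, one_ne_zero, if_neg, mul_assoc, not_false_eq_true]

lemma prod_branchMatrix_mul_flipMatrix (ks : List ℕ) :
    toPSL (ks.map fun k : ℕ => branchMatrix (-(k + 2))).prod * toPSL flipMatrix =
      toPSL flipMatrix * toPSL (wordMatrix (blocks 1 0 ks)) := by
  induction ks with
  | nil => simp [blocks, wordMatrix]
  | cons k ks ih =>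
    rw [blocks_cons, wordMatrix_cons, wordMatrix_append, wordMatrix_replicate, List.map_cons,
      List.prod_cons, map_mul, mul_assoc, ih, ← mul_assoc, ← map_mul,
      branchMatrix_mul_flipMatrix, toPSL_neg]
    simp only [digitMatrix, if_pos, one_ne_zero, if_neg, mul_assoc, not_false_eq_true, map_mul]

lemma flipMatrix_mul_T : toPSL flipMatrix * toPSL ModularGroup.T =
    toPSL ModularGroup.S * (toPSL ModularGroup.T)⁻¹ * toPSL ModularGroup.S := by
  rw [← map_inv, ← map_mul, ← map_mul, ← map_mul, ← toPSL_neg]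
  congr 1
  refine Subtype.ext ?_
  simp [ModularGroup.coe_S, ModularGroup.coe_T, flipMatrix]

lemma flipMatrix_mul_digitMatrix_one : flipMatrix * digitMatrix 1 = digitMatrix 0 := by
  refine Subtype.ext ?_
  simp [coe_lowerGen, ModularGroup.coe_S, ModularGroup.coe_T, flipMatrix, digitMatrix]

lemma matching_of_blocks {u : List (Fin 2)} {ks ls : List ℕ} (h₀ : 0 :: u = blocks 0 1 ks)
    (h₁ : 1 :: u = blocks 1 0 ls) :
    toPSL ModularGroup.T * toPSL (ks.map fun k : ℕ => branchMatrix (k + 2)).prod =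
      toPSL (ls.map fun k : ℕ => branchMatrix (-(k + 2))).prod * toPSL ModularGroup.S *
        (toPSL ModularGroup.T)⁻¹ * toPSL ModularGroup.S := by
  rw [mul_assoc, mul_assoc (toPSL _), ← mul_assoc (toPSL ModularGroup.S), ← flipMatrix_mul_T,
    ← mul_assoc, prod_branchMatrix_mul_flipMatrix, ← map_mul, T_mul_prod_branchMatrix, ← h₀, ← h₁,
    wordMatrix_cons, wordMatrix_cons, ← map_mul, ← map_mul, ← mul_assoc flipMatrix,
    flipMatrix_mul_digitMatrix_one]

/-! ### Gaps between the values of the rotated words -/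

lemma ofDigits_eq_shift (a : ℕ → Fin 2) :
    Real.ofDigits a = ((a 0 : ℕ) + Real.ofDigits (shift a)) / 2 := by
  have h := Real.ofDigits_eq_sum_add_ofDigits a 1
  rw [h]
  change _ + _ * Real.ofDigits (shift a) = _
  simp only [Finset.sum_range_one, Real.ofDigitsTerm]
  push_cast
  ring

/-- The number with binary expansion `phaseWord n p k`. -/
noncomputable def phaseValue (n p k : ℕ) : ℝ := Real.ofDigits (phaseWord n p k)

lemma phaseValue_nonneg (n p k : ℕ) : 0 ≤ phaseValue n p k := Real.ofDigits_nonneg _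

lemma phaseValue_le_one (n p k : ℕ) : phaseValue n p k ≤ 1 := Real.ofDigits_le_one _

lemma shift_phaseWord {n p k l : ℕ} (h : (k + p) % n = l % n) :
    shift (phaseWord n p k) = phaseWord n p l := by
  funext j
  simp only [shift, phaseWord]
  rw [show k + (j + 1) * p = k + p + j * p by ring, Nat.add_mod, h, ← Nat.add_mod]

lemma phaseValue_of_lt {n p k : ℕ} (h : k + p < n) :
    phaseValue n p k = phaseValue n p (k + p) / 2 := by
  have h0 : phaseWord n p k 0 = 0 := by
    simp only [phaseWord, phaseDigit]
    rw [zero_mul, add_zero, Nat.mod_eq_of_lt (by omega), if_neg (by omega)]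
  rw [phaseValue, ofDigits_eq_shift, shift_phaseWord (l := k + p) rfl, h0, phaseValue]
  simp

lemma phaseValue_of_le {n p k : ℕ} (hk : k < n) (h : n ≤ k + p) :
    phaseValue n p k = (1 + phaseValue n p (k + p - n)) / 2 := by
  have h0 : phaseWord n p k 0 = 1 := by
    simp only [phaseWord, phaseDigit]
    rw [zero_mul, add_zero, Nat.mod_eq_of_lt hk, if_pos h]
  rw [phaseValue, ofDigits_eq_shift, shift_phaseWord (l := k + p - n) (Nat.mod_eq_sub_mod h), h0,
    phaseValue]
  simp

lemma phaseValue_le_add {n p : ℕ} (hpn : p < n) (m : ℕ) : ∀ k l : ℕ, k ≤ l → l < n →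
    phaseValue n p k ≤ phaseValue n p l + (1 / 2) ^ m := by
  induction m with
  | zero =>
    intro k l _ _
    rw [pow_zero]
    linarith [phaseValue_le_one n p k, phaseValue_nonneg n p l]
  | succ m ih =>
    intro k l hkl hl
    rw [pow_succ]
    rcases lt_or_ge (l + p) n with h | h
    · rw [phaseValue_of_lt h, phaseValue_of_lt (k := k) (by omega)]
      linarith [ih (k + p) (l + p) (by omega) h]
    · rw [phaseValue_of_le hl h]
      have hpos : (0 : ℝ) < (1 / 2) ^ m := by positivity
      rcases lt_or_ge (k + p) n with h' | h'
      · rw [phaseValue_of_lt h']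
        linarith [phaseValue_le_one n p (k + p), phaseValue_nonneg n p (l + p - n)]
      · rw [phaseValue_of_le (by omega) h']
        linarith [ih (k + p - n) (l + p - n) (by omega) (by omega)]

lemma phaseValue_mono {n p k l : ℕ} (hpn : p < n) (hkl : k ≤ l) (hl : l < n) :
    phaseValue n p k ≤ phaseValue n p l := by
  refine le_of_forall_pos_le_add fun ε hε => ?_
  obtain ⟨m, hm⟩ := exists_pow_lt_of_lt_one hε (show (1 / 2 : ℝ) < 1 by norm_num)
  linarith [phaseValue_le_add hpn m k l hkl hl]

lemma centralWord_drop {n p i : ℕ} (hi : i < n - 2) : (centralWord n p).drop i =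
    phaseDigit n p ((i + 1) * p % n) :: (centralWord n p).drop (i + 1) := by
  rw [List.drop_eq_getElem_cons (by simpa [centralWord] using hi)]
  simp [centralWord]

/-- The real `z` lies between the values of phases `m` and `m + 1`, at distance at least `d` from
the former and `e` from the latter. -/
def InGap (n p : ℕ) (d e : ℝ) (m : ℕ) (z : ℝ) : Prop :=
  phaseValue n p m + d ≤ z ∧ z + e ≤ phaseValue n p (m + 1)

lemma InGap.pos {n p m : ℕ} {d e z : ℝ} (hd : 0 < d) (h : InGap n p d e m z) : 0 < z := by
  linarith [h.1, phaseValue_nonneg n p m]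

lemma InGap.lt_one {n p m : ℕ} {d e z : ℝ} (he : 0 < e) (h : InGap n p d e m z) : z < 1 := by
  linarith [h.2, phaseValue_le_one n p (m + 1)]

lemma InGap.double {n p m : ℕ} {d e z : ℝ} (hd : 0 < d) (he : 0 < e) (h : InGap n p d e m z)
    (hm : m + 1 + p < n) : InGap n p d e (m + p) (2 * z) := by
  obtain ⟨h₁, h₂⟩ := h
  rw [phaseValue_of_lt hm] at h₂
  rw [phaseValue_of_lt (by omega)] at h₁
  refine ⟨by linarith, ?_⟩
  rw [show m + p + 1 = m + 1 + p by ring]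
  linarith

lemma InGap.double_sub {n p m : ℕ} {d e z : ℝ} (hd : 0 < d) (he : 0 < e) (h : InGap n p d e m z)
    (hmn : m + 1 < n) (hm : n ≤ m + p) : InGap n p d e (m + p - n) (2 * z - 1) := by
  obtain ⟨h₁, h₂⟩ := h
  rw [phaseValue_of_le hmn (by omega)] at h₂
  rw [phaseValue_of_le (by omega) hm] at h₁
  refine ⟨by linarith, ?_⟩
  rw [show m + p - n + 1 = m + 1 + p - n by omega]
  linarith

lemma phase_ne_zero {n p i : ℕ} (hc : p.Coprime n) (hi : i + 1 < n) : (i + 1) * p % n ≠ 0 := by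
  intro h
  have h1 : n ∣ i + 1 := hc.symm.dvd_of_dvd_mul_right (Nat.dvd_of_mod_eq_zero h)
  exact absurd (Nat.le_of_dvd (by omega) h1) (by omega)

lemma phase_succ (n p i : ℕ) : (i + 1 + 1) * p % n = ((i + 1) * p % n + p) % n := by
  rw [Nat.mod_add_mod]
  congr 1
  ring

/-- Following the binary expansion of `z` along the end of the central word, from its `i`-th
digit. -/
lemma exists_wordAct_drop {n p : ℕ} {d e y : ℝ} (hp : 0 < p) (hpn : p < n) (hc : p.Coprime n)
    (hd : 0 < d) (he : 0 < e) (hy : InGap n p d e (p - 1) y) (r : ℕ) :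
    ∀ (i m : ℕ) (z : ℝ), i + r = n - 2 → (i + 1) * p % n = m + 1 → InGap n p d e m z →
    ∃ t, InGap n p d e (n - p - 1) t ∧
      wordAct ((centralWord n p).drop i) (phiExt t) = phiExt z ∧
      ∀ s, s <:+ (centralWord n p).drop i →
        (s.head? = some 0 → phiExt y / (1 + phiExt y) ≤ wordAct s (phiExt t) ∧
          wordAct s (phiExt t) < 1) ∧
        (s.head? = some 1 → 1 ≤ wordAct s (phiExt t) ∧ wordAct s (phiExt t) < 1 + phiExt y) := by
  have hy0 := hy.pos hd
  have hy1 := hy.lt_one he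
  induction r with
  | zero =>
    intro i m z hi hm hz
    obtain rfl : i = n - 2 := hi
    rw [phase_last hp hpn] at hm
    obtain rfl : m = n - p - 1 := by omega
    refine ⟨z, hz, ?_⟩
    rw [List.drop_eq_nil_of_le (by simp [centralWord])]
    refine ⟨rfl, fun s hs => ?_⟩
    rw [List.suffix_nil] at hs
    simp [hs]
  | succ r ih =>
    intro i m z hi hm hz
    have hmn : m + 1 < n := hm ▸ Nat.mod_lt _ (by omega)
    have hne := phase_ne_zero hc (i := i + 1) (by omega)
    have hnext := phase_succ n p i
    rw [hm] at hnext
    have hz0 := hz.pos hd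
    have hz1 := hz.lt_one he
    have hf := phiExt_nonneg y
    have hne' : m + 1 + p ≠ n := by
      intro h
      rw [hnext, h, Nat.mod_self] at hne
      exact hne rfl
    rw [centralWord_drop (by omega), hm]
    rcases lt_or_gt_of_ne hne' with h | h
    · have hz' := hz.double hd he h
      rw [Nat.mod_eq_of_lt h] at hnext
      obtain ⟨t, ht, hact, hs⟩ := ih (i + 1) (m + p) (2 * z) (by omega) (by omega) hz'
      have hfz : phiExt y < phiExt (2 * z) := by
        refine phiExt_lt hy0.le (hz'.lt_one he) ?_
        have := phaseValue_mono (k := p) (l := m + p) hpn (by omega) (by omega)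
        have h2 := hy.2
        rw [Nat.sub_add_cancel hp] at h2
        linarith [hz'.1]
      have hstep : wordAct (phaseDigit n p (m + 1) :: (centralWord n p).drop (i + 1)) (phiExt t) =
          phiExt (2 * z) / (1 + phiExt (2 * z)) := by
        rw [← hact, phaseDigit, if_neg (by omega)]
        rfl
      have hstep' : phiExt (2 * z) / (1 + phiExt (2 * z)) = phiExt z := by
        rw [← phiExt_half (hz'.lt_one he), mul_div_cancel_left₀ _ two_ne_zero]
      refine ⟨t, ht, hstep.trans hstep', fun s hsuf => ?_⟩
      rcases List.suffix_cons_iff.1 hsuf with rfl | hsuf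
      · rw [hstep]
        refine ⟨fun _ => ⟨?_, ?_⟩, fun h1 => ?_⟩
        · rw [div_le_div_iff₀ (by linarith) (by linarith)]
          linarith
        · rw [div_lt_one (by linarith)]
          linarith
        · rw [phaseDigit, if_neg (by omega), List.head?_cons, Option.some_inj] at h1
          exact absurd h1 (by decide)
      · exact hs s hsuf
    · have hz' := hz.double_sub hd he hmn (by omega)
      rw [Nat.mod_eq_sub_mod h.le, Nat.mod_eq_of_lt (show m + 1 + p - n < n by omega)] at hnext
      obtain ⟨t, ht, hact, hs⟩ := ih (i + 1) (m + p - n) (2 * z - 1) (by omega) (by omega) hz'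
      have hfz : phiExt (2 * z - 1) < phiExt y := by
        refine phiExt_lt (hz'.pos hd).le hy1 ?_
        have := phaseValue_mono (k := m + p - n + 1) (l := p - 1) hpn (by omega) (by omega)
        linarith [hz'.2, hy.1]
      have hstep : wordAct (phaseDigit n p (m + 1) :: (centralWord n p).drop (i + 1)) (phiExt t) =
          1 + phiExt (2 * z - 1) := by
        rw [← hact, phaseDigit, if_pos h.le]
        rfl
      have hstep' : 1 + phiExt (2 * z - 1) = phiExt z := by
        rw [← phiExt_half_add (hz'.pos hd).le (hz'.lt_one he)]
        congr 1
        ring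
      refine ⟨t, ht, hstep.trans hstep', fun s hsuf => ?_⟩
      rcases List.suffix_cons_iff.1 hsuf with rfl | hsuf
      · rw [hstep]
        refine ⟨fun h1 => ?_, fun _ => ⟨?_, ?_⟩⟩
        · rw [phaseDigit, if_pos h.le, List.head?_cons, Option.some_inj] at h1
          exact absurd h1 (by decide)
        · linarith [phiExt_nonneg (2 * z - 1)]
        · linarith
      · exact hs s hsuf

lemma InGap.phiExt_bounds {n p : ℕ} {d e y t : ℝ} (hp : 0 < p) (hpn : p < n) (hd : 0 < d)
    (he : 0 < e) (hyd : y = phaseValue n p (p - 1) + d) (hye : y + e = phaseValue n p p)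
    (ht : InGap n p d e (n - p - 1) t) :
    (1 + phiExt y) / (2 + phiExt y) ≤ phiExt t ∧
      phiExt t < 1 + phiExt y / (1 + phiExt y) := by
  have hy0 : 0 < y := by linarith [phaseValue_nonneg n p (p - 1)]
  have hy1 : y < 1 := by linarith [phaseValue_le_one n p p]
  have hf := phiExt_nonneg y
  obtain ⟨h₁, h₂⟩ := ht
  have e₁ : phaseValue n p (n - p - 1) = (1 + phaseValue n p (p - 1)) / 4 := by
    rw [phaseValue_of_lt (by omega), phaseValue_of_le (by omega) (by omega),
      show n - p - 1 + p + p - n = p - 1 by omega]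
    ring
  have e₂ : phaseValue n p (n - p - 1 + 1) = (1 + phaseValue n p p / 2) / 2 := by
    rw [phaseValue_of_le (by omega) (by omega), show n - p - 1 + 1 + p - n = 0 by omega,
      phaseValue_of_lt (by omega), zero_add]
  constructor
  · have h : phiExt ((1 + y) / 2 / 2) = (1 + phiExt y) / (2 + phiExt y) := by
      rw [phiExt_half (by linarith), phiExt_half_add hy0.le hy1]
      congr 1
      ring
    rw [← h]
    exact phiExt_le (by linarith) (by linarith [phaseValue_le_one n p (n - p - 1 + 1)])
      (by linarith)
  · rw [← phiExt_half hy1, ← phiExt_half_add (by linarith) (by linarith)]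
    exact phiExt_lt (by linarith [phaseValue_nonneg n p (n - p - 1)]) (by linarith) (by linarith)

/-- For `α` in a qumterval, the orbits of `α - 1` and `α` are coded by the central word. -/
lemma exists_wordAct_centralWord {n p : ℕ} (hp : 0 < p) (hpn : p < n) (hc : p.Coprime n) {α : ℝ}
    (hα : α ∈ qumterval (christoffel n p)) :
    ∃ τ, 0 < τ ∧ wordAct (0 :: centralWord n p) τ = α ∧
      1 - (wordAct (1 :: centralWord n p) τ)⁻¹ = α ∧
      ∀ s, s <:+ centralWord n p →
        ((s = [] ∨ s.head? = some 0) → α ≤ wordAct s τ ∧ wordAct s τ < 1 + α) ∧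
        ((s = [] ∨ s.head? = some 1) →
          α - 1 ≤ 1 - (wordAct s τ)⁻¹ ∧ 1 - (wordAct s τ)⁻¹ < α) := by
  obtain ⟨x, ⟨hx₁, hx₂⟩, rfl⟩ := hα
  rw [periodicWord_reverse_christoffel hpn, ← phaseValue, phaseValue_of_le (by omega) (by omega),
    show n - 1 + p - n = p - 1 by omega] at hx₁
  rw [periodicWord_christoffel p (by omega), ← phaseValue, phaseValue_of_lt (by omega),
    zero_add] at hx₂
  obtain ⟨d, hd⟩ : ∃ d, d = 2 * x - phaseValue n p (p - 1) := ⟨_, rfl⟩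
  obtain ⟨e, he⟩ : ∃ e, e = phaseValue n p p - 2 * x := ⟨_, rfl⟩
  have hd0 : 0 < d := by linarith
  have he0 : 0 < e := by linarith
  have hx1 : 2 * x < 1 := by linarith [phaseValue_le_one n p p]
  have hgap : InGap n p d e (p - 1) (2 * x) :=
    ⟨by linarith, by rw [Nat.sub_add_cancel hp]; linarith⟩
  obtain ⟨t, ht, hact, hs⟩ := exists_wordAct_drop hp hpn hc hd0 he0 hgap (n - 2) 0 (p - 1) (2 * x)
    (zero_add _) (by rw [zero_add, one_mul, Nat.mod_eq_of_lt hpn, Nat.sub_add_cancel hp]) hgap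
  rw [List.drop_zero] at hact hs
  obtain ⟨hb₁, hb₂⟩ := ht.phiExt_bounds hp hpn hd0 he0 (y := 2 * x) (by linarith) (by linarith)
  have hα : phi x = phiExt (2 * x) / (1 + phiExt (2 * x)) := by
    rw [← phiExt_of_lt (by linarith), ← phiExt_half hx1, mul_div_cancel_left₀ _ two_ne_zero]
  have hf := phiExt_nonneg (2 * x)
  rw [hα]
  generalize phiExt (2 * x) = f at *
  generalize phiExt t = τ at *
  have hτ : 0 < τ := lt_of_lt_of_le (by positivity) hb₁
  have hα1 : f / (1 + f) = 1 - (1 + f)⁻¹ := by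
    field_simp
    ring
  have hf1 : (1 + f)⁻¹ ≤ 1 := inv_le_one_of_one_le₀ (by linarith)
  refine ⟨τ, hτ, ?_, ?_, fun s hsuf => ⟨?_, ?_⟩⟩
  · change wordAct (centralWord n p) τ / (1 + wordAct (centralWord n p) τ) = _
    rw [hact]
  · change 1 - (1 + wordAct (centralWord n p) τ)⁻¹ = _
    rw [hact, hα1]
  · rintro (rfl | h)
    · refine ⟨le_trans ?_ hb₁, hb₂⟩
      rw [div_le_div_iff₀ (by linarith) (by linarith)]
      nlinarith
    · obtain ⟨h₁, h₂⟩ := (hs s hsuf).1 h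
      exact ⟨h₁, by linarith⟩
  · rintro (rfl | h)
    · change f / (1 + f) - 1 ≤ 1 - τ⁻¹ ∧ 1 - τ⁻¹ < f / (1 + f)
      have hi₁ : τ⁻¹ ≤ ((1 + f) / (2 + f))⁻¹ := inv_anti₀ (by positivity) hb₁
      have hi₂ : ((1 + f) / (2 + f))⁻¹ = 1 + (1 + f)⁻¹ := by
        field_simp
        ring
      have hlt : τ < 1 + f := lt_of_lt_of_le hb₂ (by
        have := div_le_self hf (show 1 ≤ 1 + f by linarith)
        linarith)
      have hi₃ : (1 + f)⁻¹ < τ⁻¹ := inv_strictAnti₀ hτ hlt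
      constructor <;> linarith
    · obtain ⟨h₁, h₂⟩ := (hs s hsuf).2 h
      have hi₁ : (wordAct s τ)⁻¹ ≤ 1 := inv_le_one_of_one_le₀ h₁
      have hi₃ : (1 + f)⁻¹ < (wordAct s τ)⁻¹ := inv_strictAnti₀ (by linarith) h₂
      have hi₄ : 0 < (1 + f)⁻¹ := by positivity
      constructor <;> linarith

end KU

theorem theoremT (w : List (Fin 2)) (hw : w ∈ KU.nondegFareyWords) :
    ∃ M M' : KU.PSL2Z,
      (∀ α ∈ KU.qumterval w,
        KU.orbitMatrix α (α - 1) (w.count 0) = M ∧ KU.orbitMatrix α α (w.count 1) = M') ∧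
      KU.toPSL ModularGroup.T * M =
        M' * KU.toPSL ModularGroup.S * (KU.toPSL ModularGroup.T)⁻¹ * KU.toPSL ModularGroup.S := by
  obtain ⟨n, p, hp, hpn, hc, rfl⟩ := KU.exists_christoffel_of_mem hw
  obtain ⟨k, ks, hk⟩ := KU.exists_blocks (a := 0) (b := 1) (by decide) (KU.centralWord n p)
  obtain ⟨l, ls, hl⟩ := KU.exists_blocks (a := 1) (b := 0) (by decide) (KU.centralWord n p)
  have hk' : 0 :: KU.centralWord n p = KU.blocks 0 1 (k :: ks) := by rw [KU.blocks_cons, ← hk]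
  have hl' : 1 :: KU.centralWord n p = KU.blocks 1 0 (l :: ls) := by rw [KU.blocks_cons, ← hl]
  have hcount₀ : (KU.christoffel n p).count 0 = (k :: ks).length := by
    rw [← KU.count_blocks (a := 0) (b := 1) (by decide), ← hk', KU.christoffel_eq hp hpn]
    simp
  have hcount₁ : (KU.christoffel n p).count 1 = (l :: ls).length := by
    rw [← KU.count_blocks (a := 1) (b := 0) (by decide), ← hl', KU.christoffel_eq hp hpn]
    simp
  refine ⟨_, _, fun α hα => ?_, KU.matching_of_blocks hk' hl'⟩
  obtain ⟨τ, hτ, h₀, h₁, hs⟩ := KU.exists_wordAct_centralWord hp hpn hc hα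
  constructor
  · rw [KU.orbitMatrix, hcount₀, ← KU.orbitDigits_blocks_zero (α := α) hτ.le (k :: ks), ← hk', h₀]
    rw [← hk', List.tail_cons]
    exact fun s hsuf => (hs s hsuf).1
  · rw [KU.orbitMatrix, hcount₁, ← KU.orbitDigits_blocks_one (α := α) hτ (l :: ls), ← hl', h₁]
    rw [← hl', List.tail_cons]
    exact fun s hsuf => (hs s hsuf).2
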